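/- **Theorem 7.4.** Let $n,q\in\mathbb N$. A set $\Omega\subset\mathbb R^m$ is *nearly convex* if there is a convex set $C$ with $C\subset\Omega\subset\overline C$; $\mathrm{ri}\,\Omega$ denotes the interior of $\Omega$ relative to its affine hull. For $\phi\colon\mathbb R^n\to[-\infty,\infty]$ put $\mathrm{dom}\,\phi=\{x\mid \phi(x)<\infty\}$; $\phi$ is *proper* if $\mathrm{dom}\,\phi\neq\emptyset$ and $\phi>-\infty$ everywhere, and *nearly convex* if its epigraph $\{(x,\lambda)\in\mathbb R^n\times\mathbb R\mid \phi(x)\le\lambda\}$ is nearly convex. For a set-valued mapping $G\colon\mathbb R^n\rightrightarrows\mathbb R^q$ put $\mathrm{dom}\,G=\{x\mid G(x)\ne\emptyset\}$ and $G(A)=\bigcup_{x\in A}G(x)$; $G$ is *nearly convex* if its graph $\{(x,y)\mid y\in G(x)\}$ is a nearly convex subset of $\mathbb R^n\times\mathbb R^q$. Let $\phi\colon\mathbb R^n\to[-\infty,\infty]$ be a proper nearly convex function, $\Theta\subset\mathbb R^n$ a nearly convex set, and $G\colon\mathbb R^n\rightrightarrows\mathbb R^q$ a nearly convex set-valued mapping.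 Suppose that $$\mathrm{ri}(\mathrm{dom}\,\phi)\cap\mathrm{ri}(\mathrm{dom}\,G)\cap\mathrm{ri}\,\Theta\neq\emptyset\quad\text{and}\quad 0\in\mathrm{ri}\big(G(\Theta\cap\mathrm{dom}\,\phi)\big).$$ For $x\in\mathbb R^n$ and $y^*\in\mathbb R^q$ let $$v_G(x,y^*)=\inf\{\langle -y^*,y\rangle\mid y\in G(x)\},\qquad h(y^*)=\inf\{\phi(x)+v_G(x,y^*)\mid x\in\Theta\},$$ with the conventions $\inf\emptyset=\infty$ and $\infty+(-\infty)=\infty$. Then Lagrange strong duality holds: $$\inf\{\phi(x)\mid x\in\Theta,\ 0\in G(x)\}=\sup_{y^*\in\mathbb R^q}h(y^*),$$ as an equality in $[-\infty,\infty]$. -/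

import Mathlib

noncomputable section

namespace NearConv

/-- A set `s` is nearly convex if `C ⊆ s ⊆ closure C` for some convex set `C`. -/
def NearlyConvexSet {V : Type*} [AddCommGroup V] [Module ℝ V] [TopologicalSpace V]
    (s : Set V) : Prop :=
  ∃ C : Set V, Convex ℝ C ∧ C ⊆ s ∧ s ⊆ closure C

/-- The effective domain of an extended-real-valued function. -/
def effDom {V : Type*} (f : V → EReal) : Set V := {x | f x < ⊤}

/-- The epigraph of an extended-real-valued function, as a subset of `V × ℝ`. -/
def epigraph {V : Type*} (f : V → EReal) : Set (V × ℝ) := {p | f p.1 ≤ (p.2 : EReal)}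

/-- A function is proper if its effective domain is nonempty and it never takes the value `-∞`. -/
def ProperFun {V : Type*} (f : V → EReal) : Prop :=
  (effDom f).Nonempty ∧ ∀ x, ⊥ < f x

/-- A function is nearly convex if its epigraph is a nearly convex set. -/
def NearlyConvexFun {V : Type*} [AddCommGroup V] [Module ℝ V] [TopologicalSpace V]
    (f : V → EReal) : Prop :=
  NearlyConvexSet (epigraph f)

/-- The domain of a set-valued mapping. -/
def mapDom {V W : Type*} (G : V → Set W) : Set V := {x | (G x).Nonempty}

/-- The graph of a set-valued mapping. -/
def mapGraph {V W : Type*} (G : V → Set W) : Set (V × W) := {p | p.2 ∈ G p.1}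

/-- The image `G(s) = ⋃_{x ∈ s} G(x)` of a set under a set-valued mapping. -/
def mapImage {V W : Type*} (G : V → Set W) (s : Set V) : Set W := ⋃ x ∈ s, G x

/-- A set-valued mapping is nearly convex if its graph is a nearly convex set. -/
def NearlyConvexMap {V W : Type*} [AddCommGroup V] [Module ℝ V] [TopologicalSpace V]
    [AddCommGroup W] [Module ℝ W] [TopologicalSpace W] (G : V → Set W) : Prop :=
  NearlyConvexSet (mapGraph G)

/-- Addition of extended reals with the convention of minimization, `∞ + (-∞) = (-∞) + ∞ = ∞`.
(Mathlib's `+` on `EReal` has `⊤ + ⊥ = ⊥`; the two agree everywhere else.) -/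
def infAdd (a b : EReal) : EReal :=
  open scoped Classical in if a = ⊤ ∨ b = ⊤ then ⊤ else a + b

/-- `v_G(x, y*) = inf {⟨-y*, y⟩ | y ∈ G(x)}`, where the infimum of the empty set is `∞`. -/
def vFun {V W : Type*} [NormedAddCommGroup W] [InnerProductSpace ℝ W]
    (G : V → Set W) (x : V) (ystar : W) : EReal :=
  ⨅ y ∈ G x, ((inner ℝ (-ystar) y : ℝ) : EReal)

/-- The Lagrange dual function `h(y*) = inf {φ(x) + v_G(x, y*) | x ∈ Θ}`. -/
def dualFun {V W : Type*} [NormedAddCommGroup W] [InnerProductSpace ℝ W]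
    (φ : V → EReal) (Θ : Set V) (G : V → Set W) (ystar : W) : EReal :=
  ⨅ x ∈ Θ, infAdd (φ x) (vFun G x ystar)

/-- The primal value `inf {φ(x) | x ∈ Θ, 0 ∈ G(x)}`. -/
def primalValue {V W : Type*} [Zero W] (φ : V → EReal) (Θ : Set V) (G : V → Set W) : EReal :=
  ⨅ x ∈ {x | x ∈ Θ ∧ (0 : W) ∈ G x}, φ x

/-- The dual value `sup {h(y*) | y*}`. -/
def dualValue {V W : Type*} [NormedAddCommGroup W] [InnerProductSpace ℝ W]
    (φ : V → EReal) (Θ : Set V) (G : V → Set W) : EReal :=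
  ⨆ ystar : W, dualFun φ Θ G ystar

end NearConv

end

open Metric Set

/-! ### Relative interiors of convex and nearly convex sets. -/

section RelativeInterior

variable {V : Type*} [NormedAddCommGroup V] [NormedSpace ℝ V]
  {V' : Type*} [NormedAddCommGroup V'] [NormedSpace ℝ V']

/-! Let `A`, `B`, `C` be convex cores of `Θ`, of the graph of `G` and of the epigraph of `φ`. The
common relative interior point lifts to relative interior points of all three, so the triples `(x,
y, t)` over the cores are dense in those over the original sets (`fiberProd_closure_subset`). The
core triples project to a convex set in `(y, t)`-space lying above the primal value `r` over `y =
0`, and `0` stays relatively interior to its `y`-projection. A nonvertical affine minorant therefore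
exists (`Convex.exists_affine_minorant`). Its inequality is closed, hence holds for all original
triples, and says that `r ≤ h(y*)` for some `y*`. The other inequality is weak duality. -/

theorem mem_intrinsicInterior_iff_exists_ball {s : Set V} {x : V} :
    x ∈ intrinsicInterior ℝ s ↔
      x ∈ affineSpan ℝ s ∧ ∃ δ > 0, ∀ y ∈ affineSpan ℝ s, dist y x < δ → y ∈ s := by
  rw [mem_intrinsicInterior]
  constructor
  · rintro ⟨y, hy, rfl⟩
    rw [mem_interior_iff_mem_nhds, Metric.mem_nhds_iff] at hy
    obtain ⟨δ, hδ, h⟩ := hy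
    exact ⟨y.2, δ, hδ, fun z hz hzy => h (show dist (⟨z, hz⟩ : affineSpan ℝ s) y < δ from hzy)⟩
  · rintro ⟨hx, δ, hδ, h⟩
    refine ⟨⟨x, hx⟩, ?_, rfl⟩
    rw [mem_interior_iff_mem_nhds, Metric.mem_nhds_iff]
    exact ⟨δ, hδ, fun z hz => h z z.2 hz⟩

theorem exists_pos_add_smul_sub_mem {s : Set V} {x z : V}
    (hx : x ∈ intrinsicInterior ℝ s) (hz : z ∈ affineSpan ℝ s) :
    ∃ ε > (0 : ℝ), x + ε • (x - z) ∈ s := by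
  obtain ⟨hxs, δ, hδ, h⟩ := mem_intrinsicInterior_iff_exists_ball.1 hx
  have hpos : 0 < ‖x - z‖ + 1 := by positivity
  refine ⟨δ / (‖x - z‖ + 1), by positivity, h _ ?_ ?_⟩
  · have := AffineMap.lineMap_mem (-(δ / (‖x - z‖ + 1))) hxs hz
    rw [AffineMap.lineMap_apply] at this
    convert this using 1
    simp only [vsub_eq_sub, vadd_eq_add]
    module
  · rw [dist_eq_norm, add_sub_cancel_left, norm_smul, Real.norm_of_nonneg (by positivity),
      div_mul_eq_mul_div, div_lt_iff₀ hpos]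
    nlinarith [norm_nonneg (x - z)]

variable [FiniteDimensional ℝ V]

theorem closure_subset_affineSpan (s : Set V) : closure s ⊆ affineSpan ℝ s :=
  closure_minimal (subset_affineSpan ℝ s) (AffineSubspace.closed_of_finiteDimensional _)

theorem Convex.openSegment_subset_intrinsicInterior {s : Set V} (hs : Convex ℝ s) {c z : V}
    (hc : c ∈ intrinsicInterior ℝ s) (hz : z ∈ closure s) :
    openSegment ℝ c z ⊆ intrinsicInterior ℝ s := by
  rintro w ⟨a, b, ha, hb, hab, rfl⟩
  obtain ⟨hcs, δ, hδ, h⟩ := mem_intrinsicInterior_iff_exists_ball.1 hc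
  have hzA : z ∈ affineSpan ℝ s := closure_subset_affineSpan s hz
  have comb : ∀ (t : ℝ) {u v : V}, u ∈ affineSpan ℝ s → v ∈ affineSpan ℝ s →
      u + t • (v - u) ∈ affineSpan ℝ s := fun t u v hu hv => by
    have := AffineMap.lineMap_mem t hu hv
    rwa [AffineMap.lineMap_apply, vsub_eq_sub, vadd_eq_add, add_comm] at this
  obtain rfl : b = 1 - a := by linarith
  refine mem_intrinsicInterior_iff_exists_ball.2 ⟨?_, a * δ / 2, by positivity, fun w hw hwd => ?_⟩
  · convert comb a hzA hcs using 1
    module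
  · obtain ⟨z', hz', hzz⟩ := Metric.mem_closure_iff.1 hz (a * δ / 2) (by positivity)
    -- Extrapolating from `z'` through `w` lands within `δ` of `c`, hence in `s`; `w` is then a
    -- convex combination of two points of `s`.
    have key : z' + a⁻¹ • (w - z') ∈ s := by
      refine h _ (comb _ (subset_affineSpan ℝ s hz') hw) ?_
      have e : z' + a⁻¹ • (w - z') - c =
          a⁻¹ • ((w - (a • c + (1 - a) • z)) + (1 - a) • (z - z')) := by
        match_scalars <;> field_simp <;> ring
      rw [dist_eq_norm, e, norm_smul, norm_inv, Real.norm_of_nonneg ha.le, inv_mul_lt_iff₀ ha]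
      rw [dist_eq_norm] at hwd hzz
      calc _ ≤ ‖w - (a • c + (1 - a) • z)‖ + ‖(1 - a) • (z - z')‖ := norm_add_le _ _
        _ ≤ ‖w - (a • c + (1 - a) • z)‖ + ‖z - z'‖ := by
          rw [norm_smul, Real.norm_of_nonneg hb.le]
          gcongr
          exact mul_le_of_le_one_left (norm_nonneg _) (by linarith)
        _ < a * δ := by linarith
    have := hs key hz' ha.le hb.le hab
    convert this using 1
    match_scalars <;> field_simp <;> ring

/-- A segment from a relative interior point of `c` to `x` can be prolonged beyond `x` within `s ⊆
closure c`, so `x` lies in an open segment of relative interior points. -/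
theorem Convex.intrinsicInterior_subset_of_subset_closure {c s : Set V} (hc : Convex ℝ c)
    (hcs : c ⊆ s) (hsc : s ⊆ closure c) : intrinsicInterior ℝ s ⊆ intrinsicInterior ℝ c := by
  intro x hx
  have hne : c.Nonempty := closure_nonempty_iff.1 ⟨x, hsc (intrinsicInterior_subset hx)⟩
  obtain ⟨w, hw⟩ := hne.intrinsicInterior hc
  obtain ⟨ε, hε, h⟩ := exists_pos_add_smul_sub_mem hx
    (subset_affineSpan ℝ s (hcs (intrinsicInterior_subset hw)))
  refine hc.openSegment_subset_intrinsicInterior hw (hsc h)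
    ⟨ε / (1 + ε), 1 / (1 + ε), by positivity, by positivity, by field_simp; ring, ?_⟩
  match_scalars <;> field_simp <;> ring

theorem Convex.intrinsicInterior_image_subset {c : Set V} (hc : Convex ℝ c) (f : V →L[ℝ] V') :
    intrinsicInterior ℝ (f '' c) ⊆ f '' intrinsicInterior ℝ c := by
  intro x hx
  have hne : c.Nonempty := image_nonempty.1 ⟨x, intrinsicInterior_subset hx⟩
  obtain ⟨w, hw⟩ := hne.intrinsicInterior hc
  obtain ⟨ε, hε, u, hu, hux⟩ := exists_pos_add_smul_sub_mem hx
    (subset_affineSpan ℝ _ (mem_image_of_mem f (intrinsicInterior_subset hw)))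
  refine ⟨(ε / (1 + ε)) • w + (1 / (1 + ε)) • u,
    hc.openSegment_subset_intrinsicInterior hw (subset_closure hu)
    ⟨_, _, by positivity, by positivity, by field_simp; ring, rfl⟩, ?_⟩
  rw [map_add, map_smul, map_smul, hux]
  match_scalars <;> field_simp <;> ring

theorem Convex.exists_mem_intrinsicInterior_of_image [FiniteDimensional ℝ V'] {c s : Set V}
    (hc : Convex ℝ c) (hcs : c ⊆ s) (hsc : s ⊆ closure c) (f : V →L[ℝ] V') {x : V'}
    (hx : x ∈ intrinsicInterior ℝ (f '' s)) : ∃ u ∈ intrinsicInterior ℝ c, f u = x :=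
  hc.intrinsicInterior_image_subset f <|
    (hc.linear_image f.toLinearMap).intrinsicInterior_subset_of_subset_closure
      (image_mono hcs) ((image_mono hsc).trans (image_closure_subset_closure_image f.continuous)) hx

end RelativeInterior

/-! ### Nonvertical separation by extension of positive functionals. -/

section Separation

variable {E : Type*} [AddCommGroup E] [Module ℝ E]

/-- The cone of nonnegative multiples of points of a nonempty convex set. -/
def Convex.pointedCone {s : Set E} (hs : Convex ℝ s) (hne : s.Nonempty) : PointedCone ℝ E where
  carrier := {z | ∃ t : ℝ, 0 ≤ t ∧ ∃ d ∈ s, z = t • d}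
  zero_mem' := ⟨0, le_rfl, hne.some, hne.some_mem, by simp⟩
  add_mem' := by
    rintro _ _ ⟨t, ht, d, hd, rfl⟩ ⟨t', ht', d', hd', rfl⟩
    rcases (add_nonneg ht ht').eq_or_lt with h | h
    · obtain rfl : t = 0 := by linarith
      obtain rfl : t' = 0 := by linarith
      exact ⟨0, le_rfl, d, hd, by simp⟩
    · refine ⟨t + t', h.le, (t / (t + t')) • d + (t' / (t + t')) • d',
        hs hd hd' (by positivity) (by positivity) (by field_simp), ?_⟩
      match_scalars <;> field_simp
  smul_mem' := by
    rintro ⟨c, hc⟩ _ ⟨t, ht, d, hd, rfl⟩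
    exact ⟨c * t, by positivity, d, hd, (mul_smul c t d).symm⟩

theorem Convex.mem_pointedCone {s : Set E} (hs : Convex ℝ s) (hne : s.Nonempty) {z : E} :
    z ∈ hs.pointedCone hne ↔ ∃ t : ℝ, 0 ≤ t ∧ ∃ d ∈ s, z = t • d := Iff.rfl

variable {W : Type*} [NormedAddCommGroup W] [InnerProductSpace ℝ W] [FiniteDimensional ℝ W]

/-- A convex set in `W × ℝ` lying above height `r` over the origin, where the origin is a relative
interior point of its projection, has a nonvertical supporting affine minorant. -/
theorem Convex.exists_affine_minorant {D : Set (W × ℝ)} (hD : Convex ℝ D) {r : ℝ}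
    (h0 : (0 : W) ∈ intrinsicInterior ℝ (Prod.fst '' D))
    (hr : ∀ t : ℝ, ((0 : W), t) ∈ D → r ≤ t) :
    ∃ y : W, ∀ d ∈ D, r ≤ d.2 + inner ℝ y d.1 := by
  have hP0 : (0 : W) ∈ Prod.fst '' D := intrinsicInterior_subset h0
  set U : Submodule ℝ W := Submodule.span ℝ (Prod.fst '' D) with hU
  have hfst : ∀ d ∈ D, d.1 ∈ U := fun d hd => Submodule.subset_span (mem_image_of_mem _ hd)
  have habs : ∀ u ∈ U, ∃ ε > (0 : ℝ), ε • u ∈ Prod.fst '' D := fun u hu => by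
    have hspan : -u ∈ affineSpan ℝ (Prod.fst '' D) := by
      rw [← SetLike.mem_coe, ← insert_eq_of_mem hP0, affineSpan_insert_zero]
      exact U.neg_mem hu
    simpa using exists_pos_add_smul_sub_mem h0 hspan
  set D' : Set (W × ℝ) := (fun d => d + ((0 : W), -r)) '' D with hD'
  have hD'c : Convex ℝ D' := by
    simpa [hD', add_comm] using hD.translate ((0 : W), -r)
  have hD'n : D'.Nonempty := (image_nonempty.1 ⟨0, hP0⟩).image _
  -- Cone points have first component in `U`, so on this domain they lie over `0`, where `hr` gives
  -- positivity. Including `Uᗮ` lets translates by the domain reach the cone from every `w`, not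
  -- only from `U`.
  let f : (W × ℝ) →ₗ.[ℝ] ℝ :=
    { domain := Uᗮ.prod ⊤
      toFun := (LinearMap.snd ℝ W ℝ).domRestrict _ }
  obtain ⟨g, hgf, hg⟩ := riesz_extension (hD'c.pointedCone hD'n) f (by
      rintro ⟨⟨m, s⟩, hms⟩ hx
      have hm : m ∈ Uᗮ := hms.1
      obtain ⟨t, ht, _, ⟨d, hd, rfl⟩, hz⟩ := hx
      simp only [Prod.ext_iff, Prod.smul_fst, Prod.smul_snd, Prod.fst_add, Prod.snd_add, add_zero,
        smul_eq_mul] at hz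
      change 0 ≤ s
      rcases ht.eq_or_lt with rfl | ht
      · simp [hz.2]
      · have hmU : m ∈ U := by
          rw [hz.1]
          exact U.smul_mem _ (hfst d hd)
        have hm0 : m = 0 := by
          have := U.inner_right_of_mem_orthogonal hmU hm
          exact inner_self_eq_zero.1 this
        have hd0 : d.1 = 0 := by
          have := hz.1
          rw [hm0, eq_comm, smul_eq_zero] at this
          exact this.resolve_left ht.ne'
        have := hr d.2 (by rw [← hd0]; exact hd)
        rw [hz.2]
        exact mul_nonneg ht.le (by linarith)) (by
      rintro ⟨w, s⟩
      obtain ⟨u, hu, v, hv, rfl⟩ := U.exists_add_mem_mem_orthogonal w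
      obtain ⟨ε, hε, d, hd, hdu⟩ := habs u hu
      refine ⟨⟨(-v, ε⁻¹ * (d.2 - r) - s), Uᗮ.neg_mem hv, trivial⟩,
        ε⁻¹, by positivity, _, mem_image_of_mem _ hd, ?_⟩
      ext
      · simp [hdu, smul_smul, inv_mul_cancel₀ hε.ne']
      · simp [sub_eq_add_neg, mul_add])
  -- The height has coefficient `1`: the supporting hyperplane is nonvertical.
  have hg1 : ∀ s : ℝ, g (0, s) = s := fun s => hgf ⟨(0, s), Uᗮ.zero_mem, trivial⟩
  let l : W →L[ℝ] ℝ := LinearMap.toContinuousLinearMap (g.comp (LinearMap.inl ℝ W ℝ))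
  refine ⟨(InnerProductSpace.toDual ℝ W).symm l, fun d hd => ?_⟩
  have h1 := hg _ ((hD'c.mem_pointedCone hD'n).2
    ⟨1, zero_le_one, _, mem_image_of_mem _ hd, (one_smul ℝ _).symm⟩)
  have h2 : d + ((0 : W), -r) = (d.1, 0) + (0, d.2 - r) := by
    ext <;> simp [sub_eq_add_neg]
  rw [h2, map_add, hg1] at h1
  rw [InnerProductSpace.toDual_symm_apply]
  change r ≤ d.2 + g (d.1, 0)
  linarith

end Separation

namespace NearConv

theorem image_fst_epigraph {V : Type*} (f : V → EReal) :
    Prod.fst '' epigraph f = effDom f := by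
  ext x
  constructor
  · rintro ⟨p, hp, rfl⟩
    exact lt_of_le_of_lt hp (EReal.coe_lt_top _)
  · intro hx
    obtain ⟨t, ht, -⟩ := EReal.lt_iff_exists_real_btwn.1 (show f x < ⊤ from hx)
    exact ⟨(x, t), ht.le, rfl⟩

theorem image_fst_mapGraph {V W : Type*} (G : V → Set W) :
    Prod.fst '' mapGraph G = mapDom G := by
  ext x
  constructor
  · rintro ⟨p, hp, rfl⟩
    exact ⟨p.2, hp⟩
  · rintro ⟨y, hy⟩
    exact ⟨(x, y), hy, rfl⟩

/-- Weak duality. -/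
theorem dualValue_le_primalValue {V W : Type*} [NormedAddCommGroup W] [InnerProductSpace ℝ W]
    (φ : V → EReal) (Θ : Set V) (G : V → Set W) : dualValue φ Θ G ≤ primalValue φ Θ G := by
  refine iSup_le fun y => le_iInf₂ fun x hx => (iInf₂_le x hx.1).trans ?_
  have hv : vFun G x y ≤ 0 := (iInf₂_le 0 hx.2).trans (by simp)
  unfold infAdd
  split_ifs with h
  · rcases h with h | h
    · exact h.ge
    · simp [h] at hv
  · simpa using add_le_add (le_refl (φ x)) hv

theorem le_dualFun {V W : Type*} [NormedAddCommGroup W] [InnerProductSpace ℝ W]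
    {φ : V → EReal} {Θ : Set V} {G : V → Set W} (hφ : ∀ x, ⊥ < φ x) {r : ℝ} {ystar : W}
    (h : ∀ x ∈ Θ, ∀ y ∈ G x, ∀ t : ℝ, φ x ≤ t → r ≤ t + inner ℝ (-ystar) y) :
    (r : EReal) ≤ dualFun φ Θ G ystar := by
  refine le_iInf₂ fun x hx => ?_
  unfold infAdd
  split_ifs with htop
  · exact le_top
  · push Not at htop
    lift φ x to ℝ using ⟨htop.1, (hφ x).ne'⟩ with t ht
    have hv : ((r - t : ℝ) : EReal) ≤ vFun G x ystar := le_iInf₂ fun y hy => by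
      have := h x hx y hy t ht.ge
      exact EReal.coe_le_coe_iff.2 (by linarith)
    calc (r : EReal) = (t : EReal) + ((r - t : ℝ) : EReal) := by
          rw [← EReal.coe_add, add_sub_cancel]
      _ ≤ _ := by gcongr

/-! ### Strong duality through fibre products. -/

section Duality

variable {V : Type*} [NormedAddCommGroup V] [NormedSpace ℝ V]
  {W : Type*} [NormedAddCommGroup W] [InnerProductSpace ℝ W]

/-- The points `(x, y, t)` over `x ∈ A` with `(x, y) ∈ B` and `(x, t) ∈ C`. -/
def fiberProd (A : Set V) (B : Set (V × W)) (C : Set (V × ℝ)) : Set (V × W × ℝ) :=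
  {p | p.1 ∈ A ∧ (p.1, p.2.1) ∈ B ∧ (p.1, p.2.2) ∈ C}

theorem convex_fiberProd {A : Set V} {B : Set (V × W)} {C : Set (V × ℝ)} (hA : Convex ℝ A)
    (hB : Convex ℝ B) (hC : Convex ℝ C) : Convex ℝ (fiberProd A B C) :=
  fun _ hp _ hq _ _ ha hb hab =>
    ⟨hA hp.1 hq.1 ha hb hab, hB hp.2.1 hq.2.1 ha hb hab, hC hp.2.2 hq.2.2 ha hb hab⟩

variable [FiniteDimensional ℝ V] [FiniteDimensional ℝ W]

/-- The open segment from the common relative interior point to `p` stays in all three sets and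
accumulates at `p`. -/
theorem fiberProd_closure_subset {A : Set V} {B : Set (V × W)} {C : Set (V × ℝ)}
    (hA : Convex ℝ A) (hB : Convex ℝ B) (hC : Convex ℝ C) {x : V} {y : W} {t : ℝ}
    (hxA : x ∈ intrinsicInterior ℝ A) (hxB : (x, y) ∈ intrinsicInterior ℝ B)
    (hxC : (x, t) ∈ intrinsicInterior ℝ C) :
    fiberProd (closure A) (closure B) (closure C) ⊆ closure (fiberProd A B C) := by
  intro p hp
  have hsub : openSegment ℝ (x, y, t) p ⊆ fiberProd A B C := by
    rintro _ ⟨a, b, ha, hb, hab, rfl⟩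
    exact ⟨intrinsicInterior_subset <|
        hA.openSegment_subset_intrinsicInterior hxA hp.1 ⟨a, b, ha, hb, hab, rfl⟩,
      intrinsicInterior_subset <|
        hB.openSegment_subset_intrinsicInterior hxB hp.2.1 ⟨a, b, ha, hb, hab, rfl⟩,
      intrinsicInterior_subset <|
        hC.openSegment_subset_intrinsicInterior hxC hp.2.2 ⟨a, b, ha, hb, hab, rfl⟩⟩
  refine closure_mono hsub ?_
  rw [closure_openSegment]
  exact right_mem_segment ℝ _ _

theorem primalValue_le_dualValue {φ : V → EReal} {Θ : Set V} {G : V → Set W}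
    (hφ_proper : ProperFun φ) (hφ : NearlyConvexFun φ) (hΘ : NearlyConvexSet Θ)
    (hG : NearlyConvexMap G)
    (hri : (intrinsicInterior ℝ (effDom φ) ∩ intrinsicInterior ℝ (mapDom G) ∩
      intrinsicInterior ℝ Θ).Nonempty)
    (hzero : (0 : W) ∈ intrinsicInterior ℝ (mapImage G (Θ ∩ effDom φ))) :
    primalValue φ Θ G ≤ dualValue φ Θ G := by
  obtain ⟨A, hA, hAs, hAc⟩ := hΘ
  obtain ⟨B, hB, hBs, hBc⟩ := hG
  obtain ⟨C, hC, hCs, hCc⟩ := hφ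
  obtain ⟨x, ⟨hxφ, hxG⟩, hxΘ⟩ := hri
  rw [← image_fst_epigraph] at hxφ
  rw [← image_fst_mapGraph] at hxG
  obtain ⟨⟨_, t⟩, hxC, rfl⟩ := hC.exists_mem_intrinsicInterior_of_image hCs hCc
    (ContinuousLinearMap.fst ℝ V ℝ) hxφ
  obtain ⟨⟨x', y⟩, hxB, rfl : x' = _⟩ := hB.exists_mem_intrinsicInterior_of_image hBs hBc
    (ContinuousLinearMap.fst ℝ V W) hxG
  have hxA := hA.intrinsicInterior_subset_of_subset_closure hAs hAc hxΘ
  have hKc := convex_fiberProd hA hB hC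
  have hKL : fiberProd A B C ⊆ fiberProd Θ (mapGraph G) (epigraph φ) :=
    fun p hp => ⟨hAs hp.1, hBs hp.2.1, hCs hp.2.2⟩
  have hLK : fiberProd Θ (mapGraph G) (epigraph φ) ⊆ closure (fiberProd A B C) := fun p hp =>
    fiberProd_closure_subset hA hB hC hxA hxB hxC ⟨hAc hp.1, hBc hp.2.1, hCc hp.2.2⟩
  have hM : mapImage G (Θ ∩ effDom φ) =
      (fun p : V × W × ℝ => p.2.1) '' fiberProd Θ (mapGraph G) (epigraph φ) := by
    ext w
    simp only [mapImage, mem_iUnion, exists_prop]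
    constructor
    · rintro ⟨u, ⟨huΘ, hu⟩, hw⟩
      rw [← image_fst_epigraph] at hu
      obtain ⟨⟨_, s⟩, hs, rfl⟩ := hu
      exact ⟨(_, w, s), ⟨huΘ, hw, hs⟩, rfl⟩
    · rintro ⟨⟨u, w, s⟩, ⟨huΘ, hw, hs⟩, rfl⟩
      exact ⟨u, ⟨huΘ, lt_of_le_of_lt hs (EReal.coe_lt_top _)⟩, hw⟩
  have h0 : (0 : W) ∈ intrinsicInterior ℝ
      ((fun p : V × W × ℝ => p.2.1) '' fiberProd A B C) := by
    rw [hM] at hzero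
    exact (hKc.linear_image
      (LinearMap.fst ℝ W ℝ ∘ₗ LinearMap.snd ℝ V (W × ℝ))).intrinsicInterior_subset_of_subset_closure
      (image_mono hKL)
      ((image_mono hLK).trans (image_closure_subset_closure_image (by fun_prop))) hzero
  -- Since `0` lies in the image, some feasible point has finite cost, so the primal value is not
  -- `⊤`.
  obtain ⟨⟨u, _, s⟩, ⟨huΘ, huG, hus⟩, rfl⟩ := hM ▸ intrinsicInterior_subset hzero
  have htop : primalValue φ Θ G ≠ ⊤ :=
    ((iInf₂_le u ⟨huΘ, huG⟩).trans_lt (lt_of_le_of_lt hus (EReal.coe_lt_top s))).ne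
  rcases eq_or_ne (primalValue φ Θ G) ⊥ with hbot | hbot
  · rw [hbot]
    exact bot_le
  lift primalValue φ Θ G to ℝ using ⟨htop, hbot⟩ with r hr
  obtain ⟨ystar, hy⟩ := (hKc.linear_image (LinearMap.snd ℝ V (W × ℝ))).exists_affine_minorant
    (r := r) (by rw [image_image]; exact h0) (by
      rintro s' ⟨⟨u', _⟩, hu', rfl⟩
      obtain ⟨h1, h2, h3⟩ := hKL hu'
      exact EReal.coe_le_coe_iff.1 (hr.le.trans ((iInf₂_le u' ⟨h1, h2⟩).trans h3)))
  -- The minorant is known only over the convex cores; closedness of the half-space carries it to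
  -- the original sets.
  have hcl : fiberProd Θ (mapGraph G) (epigraph φ) ⊆
      {p | r ≤ p.2.2 + inner ℝ ystar p.2.1} :=
    hLK.trans <| closure_minimal (fun p hp => hy p.2 (mem_image_of_mem _ hp))
      (isClosed_le (by fun_prop) (by fun_prop))
  refine le_trans (le_dualFun hφ_proper.2 (ystar := -ystar) fun x' hx' y' hy' t' ht' => ?_)
    (le_iSup (dualFun φ Θ G) (-ystar))
  rw [neg_neg]
  exact hcl (show (x', y', t') ∈ _ from ⟨hx', hy', ht'⟩)

end Duality

end NearConv

theorem theorem7p4 (n q : ℕ)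
    (φ : EuclideanSpace ℝ (Fin n) → EReal)
    (Θ : Set (EuclideanSpace ℝ (Fin n)))
    (G : EuclideanSpace ℝ (Fin n) → Set (EuclideanSpace ℝ (Fin q)))
    (hφ_proper : NearConv.ProperFun φ)
    (hφ : NearConv.NearlyConvexFun φ)
    (hΘ : NearConv.NearlyConvexSet Θ)
    (hG : NearConv.NearlyConvexMap G)
    (hri : (intrinsicInterior ℝ (NearConv.effDom φ) ∩
      intrinsicInterior ℝ (NearConv.mapDom G) ∩ intrinsicInterior ℝ Θ).Nonempty)
    (hzero : (0 : EuclideanSpace ℝ (Fin q)) ∈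
      intrinsicInterior ℝ (NearConv.mapImage G (Θ ∩ NearConv.effDom φ))) :
    NearConv.primalValue φ Θ G = NearConv.dualValue φ Θ G :=
  le_antisymm (NearConv.primalValue_le_dualValue hφ_proper hφ hΘ hG hri hzero)
    (NearConv.dualValue_le_primalValue φ Θ G)
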